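/- Throughout, natural numbers are positive and $\log$ is to base $2$. For $\varphi\in\mathbb Z[x]$, a natural number $s$ and a finite set $B\subseteq\mathbb Z$, let $E_{s,\vec\varphi}(B)$, where $\vec\varphi=(\varphi,\dots,\varphi)\in(\mathbb Z[x])^{2s}$, be the number of $(b_1,\dots,b_{2s})\in B^{2s}$ with $\varphi(b_1)+\dots+\varphi(b_s)=\varphi(b_{s+1})+\dots+\varphi(b_{2s})$, and let $M_s(B)$ be the number of $(b_1,\dots,b_{2s})\in B^{2s}$ with $b_1\cdots b_s=b_{s+1}\cdots b_{2s}$. A finite set $X\subseteq\mathbb Z$ is a $B^+_{s,\varphi}[1]$ set if every $n\in\mathbb Z$ has at most one representation $n=\varphi(x_1)+\dots+\varphi(x_s)$ with $x_1,\dots,x_s\in X$, up to the ordering of the summands $\varphi(x_1),\dots,\varphi(x_s)$. It is a $B^\times_s[1]$ set (a multiplicative Sidon set) if every $n\in\mathbb Z$ has at most one representation $n=x_1\cdots x_s$ with $x_1,\dots,x_s\in X$, up to the ordering of the factors. (i) Let $d,s$ be natural numbers with $s\ge 10d(d+1)$ and let $\varphi\in\mathbb Z[x]$ have degree $d$. There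 is a constant $c>0$, depending only on $s$ and $\varphi$, such that for every natural number $N$ there is a finite set $A\subseteq\mathbb N$ with $|A|\ge N$ such that every $B\subseteq A$ with $|B|\ge|A|/2$ satisfies $$E_{s,\vec\varphi}(B)\ \ge\ c\,|A|^{s+s/3-(d^2+d+2)/6}\quad\text{and}\quad M_s(B)\ \ge\ c\,|A|^{s+s/3-(d^2+d+2)/6}.$$ (ii) Let $s$ be an even natural number and $d$ a natural number. There are constants $K>0$, depending only on $s$, and $C>0$, depending only on $s$ and $d$, such that for every $\varphi\in\mathbb Z[x]$ of degree $d$ and every natural number $N$ there is a finite set $A'\subseteq\mathbb N$ with $|A'|\ge N$ such that the largest $B^+_{s,\varphi}[1]$ subset $X$ and the largest $B^\times_s[1]$ subset $Y$ of $A'$ satisfy $$|X|\ \le\ C\,|A'|^{d/s}(\log|A'|)^{2d/s}\quad\text{and}\quad |Y|\ \le\ K\,|A'|^{1/2+1/(2s+2)}.$$ -/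

import Mathlib

open Polynomial

/-- The additive mixed energy `E_{s,φ}(A)` of a finite set `A` of integers: the number of tuples
`(a_1, …, a_{2s}) ∈ A^{2s}` such that
`φ_1(a_1) + ⋯ + φ_s(a_s) = φ_{s+1}(a_{s+1}) + ⋯ + φ_{2s}(a_{2s})`.
The indices `1, …, 2s` are the elements of `Fin (s + s)`; the first half is
`Fin.castAdd s i` and the second half is `Fin.natAdd s i`. -/
def addEnergy (s : ℕ) (φ : Fin (s + s) → ℤ[X]) (A : Finset ℤ) : ℕ :=
  ((Fintype.piFinset fun _ : Fin (s + s) => A).filter fun a =>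
    ∑ i : Fin s, (φ (Fin.castAdd s i)).eval (a (Fin.castAdd s i)) =
      ∑ i : Fin s, (φ (Fin.natAdd s i)).eval (a (Fin.natAdd s i))).card

/-- The multiplicative mixed energy `M_{s,φ}(A)`: the number of tuples
`(a_1, …, a_{2s}) ∈ A^{2s}` such that
`φ_1(a_1) ⋯ φ_s(a_s) = φ_{s+1}(a_{s+1}) ⋯ φ_{2s}(a_{2s})`. -/
def mulEnergy (s : ℕ) (φ : Fin (s + s) → ℤ[X]) (A : Finset ℤ) : ℕ :=
  ((Fintype.piFinset fun _ : Fin (s + s) => A).filter fun a =>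
    ∏ i : Fin s, (φ (Fin.castAdd s i)).eval (a (Fin.castAdd s i)) =
      ∏ i : Fin s, (φ (Fin.natAdd s i)).eval (a (Fin.natAdd s i))).card

/-- `X` is a `B_{s,φ}^+[1]` set: every integer `n` has at most one representation
`n = φ(x_1) + ⋯ + φ(x_s)` with `x_1, …, x_s ∈ X`, where two representations are the same when
they differ only in the ordering of the summands `φ(x_1), …, φ(x_s)`.
(A set for which `x_1, …, x_s` itself is determined up to order satisfies this too.) -/
def IsAddSidon (s : ℕ) (φ : ℤ[X]) (X : Finset ℤ) : Prop :=
  ∀ x y : Fin s → ℤ, (∀ i, x i ∈ X) → (∀ i, y i ∈ X) →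
    ∑ i, φ.eval (x i) = ∑ i, φ.eval (y i) →
      ∃ σ : Equiv.Perm (Fin s), ∀ i, φ.eval (y i) = φ.eval (x (σ i))

/-- `Y` is a `B_s^×[1]` set, also called a multiplicative Sidon set: every integer `n` has, up to
the ordering of the factors, at most one representation `n = y_1 ⋯ y_s` with
`y_1, …, y_s ∈ Y`. -/
def IsMulSidon (s : ℕ) (Y : Finset ℤ) : Prop :=
  ∀ x y : Fin s → ℤ, (∀ i, x i ∈ Y) → (∀ i, y i ∈ Y) →
    ∏ i, x i = ∏ i, y i → ∃ σ : Equiv.Perm (Fin s), ∀ i, y i = x (σ i)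

/-!
For the energies, take `A = {(2 i + 1) 2 ^ j : i < P, j < L}`. A sum of `s` values of `φ` along a fixed
`j` is determined by `j` and the first `d` power sums of the odd parts, hence takes few values; a product
of `s` elements is determined by the product of the odd parts and the sum of the exponents `j`, and
again takes few values. Cauchy-Schwarz turns both facts into lower bounds for the energies of every
dense subset (`card_pow_le_addEnergy`, `card_pow_le_mulEnergy`), and `P`, `L` are powers of the same
integer chosen to balance the two.

For Sidon sets, take `A = {u v}` with `u ≤ k ^ s` and `v` in a set of `k ^ (s + 2)` primes exceeding
`k ^ s`, so that the products are distinct. A subset `T` of `A` is then a bipartite graph with edges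
`u v`. If `T` is a multiplicative Sidon set, two short paths with common end points would yield two
equal products of edges, so that balls of radius `s` are trees (`parent_unique_of_isMulSidon`). As `s`
is even, layer `s` around a vertex on the small side stays on that side, and a Moore bound
gives `|T| ≤ 3 k ^ (s + 2)` (`card_le_of_isMulSidon`). By Chebyshev's bound the primes can be chosen so
that `A` is contained in an interval of length `O_s(|A| log |A|)`; as the sums of `s` values of `φ` on an
additive Sidon set are essentially distinct, counting them bounds its size (`card_isAddSidon_le`).
One power of `log |A|` comes from the density of the primes, and the other one absorbs the
coefficients of `φ`, which makes the constant uniform in `φ`.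
-/

/-! ### Energies and collisions -/

/-- Cauchy-Schwarz: a map from `F` taking at most `|Q|` values has at least `|F| ^ 2 / |Q|`
collisions. -/
theorem card_sq_le_card_mul_card_collisions {α κ : Type*} [DecidableEq κ] (F : Finset α)
    (g : α → κ) (Q : Finset κ) (hg : ∀ x ∈ F, g x ∈ Q) :
    F.card ^ 2 ≤ Q.card * ((F ×ˢ F).filter fun p => g p.1 = g p.2).card := by
  have h1 : F.card = ∑ q ∈ Q, (F.filter fun x => g x = q).card :=
    Finset.card_eq_sum_card_fiberwise hg
  have h2 : ((F ×ˢ F).filter fun p => g p.1 = g p.2).card =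
      ∑ q ∈ Q, (F.filter fun x => g x = q).card ^ 2 := by
    rw [Finset.card_eq_sum_card_fiberwise (f := fun p : α × α => g p.1) (t := Q)]
    · refine Finset.sum_congr rfl fun q _ => ?_
      rw [sq, ← Finset.card_product]
      congr 1
      ext ⟨x, y⟩
      simp only [Finset.mem_filter, Finset.mem_product]
      constructor
      · rintro ⟨⟨⟨hx, hy⟩, h⟩, rfl⟩
        exact ⟨⟨hx, rfl⟩, hy, h.symm⟩
      · rintro ⟨⟨hx, rfl⟩, hy, h⟩
        exact ⟨⟨⟨hx, hy⟩, h.symm⟩, rfl⟩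
    · intro p hp
      simp only [Finset.coe_filter, Finset.mem_product, Set.mem_ofPred_eq] at hp
      exact hg _ hp.1.1
  rw [h2, h1]
  exact sq_sum_le_card_mul_sum_sq

/-- Colliding pairs of `s`-tuples give, by concatenation, distinct `2 s`-tuples counted by an
energy. -/
theorem card_collisions_le_card_filter_piFinset {ι κ : Type*} [DecidableEq κ] {s : ℕ}
    (B : Finset ℤ) {e : ι → ℤ} (he : e.Injective) (F : Finset (Fin s → ι))
    (hF : ∀ x ∈ F, ∀ i, e (x i) ∈ B) (g : (Fin s → ι) → κ) (P : (Fin (s + s) → ℤ) → Prop)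
    [DecidablePred P]
    (hP : ∀ x ∈ F, ∀ y ∈ F, g x = g y → P (Fin.append (e ∘ x) (e ∘ y))) :
    ((F ×ˢ F).filter fun p => g p.1 = g p.2).card ≤
      ((Fintype.piFinset fun _ : Fin (s + s) => B).filter P).card := by
  refine Finset.card_le_card_of_injOn (fun p => Fin.append (e ∘ p.1) (e ∘ p.2)) ?_ ?_
  · rintro ⟨x, y⟩ hp
    simp only [Finset.coe_filter, Finset.mem_product, Set.mem_ofPred_eq] at hp
    simp only [Finset.coe_filter, Fintype.mem_piFinset, Set.mem_ofPred_eq]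
    refine ⟨fun i => ?_, hP x hp.1.1 y hp.1.2 hp.2⟩
    refine Fin.addCases (fun j => ?_) (fun j => ?_) i
    · rw [Fin.append_left]
      exact hF x hp.1.1 j
    · rw [Fin.append_right]
      exact hF y hp.1.2 j
  · rintro ⟨x, y⟩ - ⟨x', y'⟩ - h
    have h' := (Fin.appendEquiv s s).injective (a₁ := (e ∘ x, e ∘ y)) (a₂ := (e ∘ x', e ∘ y')) h
    simp only [Prod.mk.injEq] at h' ⊢
    exact ⟨he.comp_left h'.1, he.comp_left h'.2⟩

theorem card_sq_le_card_mul_addEnergy {ι κ : Type*} [DecidableEq κ] {s : ℕ} (φ : ℤ[X])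
    (B : Finset ℤ) {e : ι → ℤ} (he : e.Injective) (F : Finset (Fin s → ι))
    (hF : ∀ x ∈ F, ∀ i, e (x i) ∈ B) (g : (Fin s → ι) → κ) (Q : Finset κ) (hQ : ∀ x ∈ F, g x ∈ Q)
    (hg : ∀ x ∈ F, ∀ y ∈ F, g x = g y → ∑ i, φ.eval (e (x i)) = ∑ i, φ.eval (e (y i))) :
    F.card ^ 2 ≤ Q.card * addEnergy s (fun _ => φ) B := by
  refine (card_sq_le_card_mul_card_collisions F g Q hQ).trans (Nat.mul_le_mul_left _ ?_)
  refine card_collisions_le_card_filter_piFinset B he F hF g _ fun x hx y hy h => ?_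
  simpa only [Fin.append_left, Fin.append_right, Function.comp] using hg x hx y hy h

theorem card_sq_le_card_mul_mulEnergy {ι κ : Type*} [DecidableEq κ] {s : ℕ}
    (B : Finset ℤ) {e : ι → ℤ} (he : e.Injective) (F : Finset (Fin s → ι))
    (hF : ∀ x ∈ F, ∀ i, e (x i) ∈ B) (g : (Fin s → ι) → κ) (Q : Finset κ) (hQ : ∀ x ∈ F, g x ∈ Q)
    (hg : ∀ x ∈ F, ∀ y ∈ F, g x = g y → ∏ i, e (x i) = ∏ i, e (y i)) :
    F.card ^ 2 ≤ Q.card * mulEnergy s (fun _ => X) B := by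
  refine (card_sq_le_card_mul_card_collisions F g Q hQ).trans (Nat.mul_le_mul_left _ ?_)
  refine card_collisions_le_card_filter_piFinset B he F hF g _ fun x hx y hy h => ?_
  simpa only [Fin.append_left, Fin.append_right, Function.comp, eval_X] using hg x hx y hy h

/-! ### Energies of dense subsets of `{(2 i + 1) 2 ^ j}` -/

/-- The integer `(2 i + 1) 2 ^ j`, encoded by the pair `(i, j)`. -/
def oddMulTwoPow (p : ℕ × ℕ) : ℤ := ((2 * p.1 + 1) * 2 ^ p.2 : ℕ)

theorem oddMulTwoPow_injective : Function.Injective oddMulTwoPow := by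
  rintro ⟨i, j⟩ ⟨i', j'⟩ h
  have h' : 2 ^ j * (2 * i + 1) = 2 ^ j' * (2 * i' + 1) := by
    have h0 : (2 * i + 1) * 2 ^ j = (2 * i' + 1) * 2 ^ j' := Int.ofNat_injective h
    rw [mul_comm, h0, mul_comm]
  have key : ∀ a b : ℕ, (2 ^ b * (2 * a + 1)).factorization 2 = b := by
    intro a b
    have : (2 * a + 1).factorization 2 = 0 := Nat.factorization_eq_zero_of_not_dvd (by omega)
    rw [Nat.factorization_mul (by positivity) (by omega)]
    simp [this, Nat.prime_two.factorization_self]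
  have hj : j = j' := by rw [← key i j, h', key]
  subst hj
  have := Nat.eq_of_mul_eq_mul_left (by positivity) h'
  simp only [Prod.mk.injEq, and_true]
  omega

theorem sum_eval_eq_of_power_sums_eq {s d : ℕ} {φ : ℤ[X]} (hφ : φ.natDegree ≤ d)
    {x y : Fin s → ℕ × ℕ} {j : ℕ} (hx : ∀ i, (x i).2 = j) (hy : ∀ i, (y i).2 = j)
    (h : ∀ k : Fin d, ∑ i, (2 * (x i).1 + 1) ^ (k + 1 : ℕ) = ∑ i, (2 * (y i).1 + 1) ^ (k + 1 : ℕ)) :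
    ∑ i, φ.eval (oddMulTwoPow (x i)) = ∑ i, φ.eval (oddMulTwoPow (y i)) := by
  have key : ∀ z : Fin s → ℕ × ℕ, (∀ i, (z i).2 = j) → ∑ i, φ.eval (oddMulTwoPow (z i)) =
      ∑ k ∈ Finset.range (d + 1), φ.coeff k * 2 ^ (j * k) *
        ((∑ i, (2 * (z i).1 + 1) ^ k : ℕ) : ℤ) := by
    intro z hz
    simp only [eval_eq_sum_range' (Nat.lt_succ_of_le hφ)]
    rw [Finset.sum_comm]
    refine Finset.sum_congr rfl fun k _ => ?_
    push_cast
    rw [Finset.mul_sum]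
    refine Finset.sum_congr rfl fun i _ => ?_
    rw [oddMulTwoPow, hz i]
    push_cast
    rw [mul_pow, ← pow_mul]
    ring
  rw [key x hx, key y hy]
  refine Finset.sum_congr rfl fun k hk => ?_
  rcases k with _ | k
  · simp
  · rw [h ⟨k, by simpa using hk⟩]

theorem prod_eq_of_prod_odd_eq {s : ℕ} {x y : Fin s → ℕ × ℕ}
    (h1 : ∏ i, (2 * (x i).1 + 1) = ∏ i, (2 * (y i).1 + 1))
    (h2 : ∑ i, (x i).2 = ∑ i, (y i).2) :
    ∏ i, oddMulTwoPow (x i) = ∏ i, oddMulTwoPow (y i) := by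
  simp only [oddMulTwoPow, ← Nat.cast_prod, Finset.prod_mul_distrib, Finset.prod_pow_eq_pow_sum,
    h1, h2]

/-- By the power mean inequality, `B` has at least `|B| ^ s / L ^ (s - 1)` tuples that lie in a single
fibre of the second projection. -/
theorem card_pow_le_card_fibre_tuples {s L : ℕ} (hs : 1 ≤ s) (B : Finset (ℕ × ℕ))
    (hB : ∀ p ∈ B, p.2 < L) :
    B.card ^ s ≤ L ^ (s - 1) * ((Fintype.piFinset fun _ : Fin s => B).filter
      fun x => ∀ i, (x i).2 = (x ⟨0, hs⟩).2).card := by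
  have h1 : B.card = ∑ j ∈ Finset.range L, (B.filter fun p => p.2 = j).card :=
    Finset.card_eq_sum_card_fiberwise (fun p hp => by simpa using hB p hp)
  have h2 : ((Fintype.piFinset fun _ : Fin s => B).filter
      fun x => ∀ i, (x i).2 = (x ⟨0, hs⟩).2).card =
      ∑ j ∈ Finset.range L, (B.filter fun p => p.2 = j).card ^ s := by
    rw [Finset.card_eq_sum_card_fiberwise (f := fun x => (x ⟨0, hs⟩).2) (t := Finset.range L)]
    · refine Finset.sum_congr rfl fun j _ => ?_
      have : (B.filter fun p => p.2 = j).card ^ s =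
        (Fintype.piFinset fun _ : Fin s => B.filter fun p => p.2 = j).card := by simp
      rw [this]
      congr 1
      ext x
      simp only [Finset.mem_filter, Fintype.mem_piFinset]
      constructor
      · rintro ⟨⟨h, h'⟩, rfl⟩ i
        exact ⟨h i, h' i⟩
      · intro h
        exact ⟨⟨fun i => (h i).1, fun i => by rw [(h i).2, (h _).2]⟩, (h _).2⟩
    · intro x hx
      simp only [Finset.coe_filter, Fintype.mem_piFinset, Set.mem_ofPred_eq] at hx
      simpa using hB _ (hx.1 _)
  rw [h2, h1]
  obtain ⟨n, rfl⟩ : ∃ n, s = n + 1 := ⟨s - 1, by omega⟩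
  have h3 := pow_sum_div_card_le_sum_pow (α := ℝ) (s := Finset.range L)
    (f := fun j => ((B.filter fun p => p.2 = j).card : ℝ)) (fun _ _ => Nat.cast_nonneg _) n
  rw [Finset.card_range] at h3
  rcases Nat.eq_zero_or_pos L with rfl | hL
  · simp
  rw [div_le_iff₀' (by positivity)] at h3
  exact_mod_cast h3

/-- With `P` odd parts and `L` powers of two, every set `B` of pairs has additive energy at least
`|B| ^ (2 s) / (L ^ (2 s - 1) P ^ D)` up to a constant, where `D = 1 + ⋯ + d`: a sum along one
fibre of `oddMulTwoPow` is determined by the first `d` power sums of the odd parts. -/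
theorem card_pow_le_addEnergy {s d P L : ℕ} (hs : 1 ≤ s) (hP : 1 ≤ P) {φ : ℤ[X]}
    (hφ : φ.natDegree ≤ d) (B : Finset (ℕ × ℕ)) (hB1 : ∀ p ∈ B, p.1 < P) (hB2 : ∀ p ∈ B, p.2 < L) :
    B.card ^ (2 * s) ≤ (s * 2 ^ d + 1) ^ d * L ^ (2 * s - 1) * P ^ (∑ k : Fin d, (k + 1 : ℕ)) *
      addEnergy s (fun _ => φ) (B.image oddMulTwoPow) := by
  set F := (Fintype.piFinset fun _ : Fin s => B).filter
      fun x => ∀ i, (x i).2 = (x ⟨0, hs⟩).2 with hFdef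
  have h1 : B.card ^ s ≤ L ^ (s - 1) * F.card := card_pow_le_card_fibre_tuples hs B hB2
  have hmem : ∀ x ∈ F, (∀ i, x i ∈ B) ∧ ∀ i, (x i).2 = (x ⟨0, hs⟩).2 := fun x hx => by
    simpa [hFdef] using hx
  let g : (Fin s → ℕ × ℕ) → ℕ × (Fin d → ℕ) :=
    fun x => ((x ⟨0, hs⟩).2, fun k => ∑ i, (2 * (x i).1 + 1) ^ (k + 1 : ℕ))
  let Q : Finset (ℕ × (Fin d → ℕ)) := Finset.range L ×ˢ
    Fintype.piFinset fun k : Fin d => Finset.range (s * (2 * P) ^ (k + 1 : ℕ) + 1)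
  have h2 : F.card ^ 2 ≤ Q.card * addEnergy s (fun _ => φ) (B.image oddMulTwoPow) := by
    refine card_sq_le_card_mul_addEnergy φ _ oddMulTwoPow_injective F
      (fun x hx i => Finset.mem_image_of_mem _ ((hmem x hx).1 i)) g Q ?_ ?_
    · intro x hx
      simp only [Q, g, Finset.mem_product, Finset.mem_range, Fintype.mem_piFinset]
      refine ⟨hB2 _ ((hmem x hx).1 _), fun k => Nat.lt_succ_of_le ?_⟩
      refine (Finset.sum_le_card_nsmul _ _ ((2 * P) ^ (k + 1 : ℕ)) fun i _ => ?_).trans (by simp)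
      have := hB1 _ ((hmem x hx).1 i)
      exact Nat.pow_le_pow_left (by omega) _
    · intro x hx y hy h
      simp only [g, Prod.mk.injEq] at h
      refine sum_eval_eq_of_power_sums_eq hφ (hmem x hx).2 (fun i => ?_) fun k => congrFun h.2 k
      rw [(hmem y hy).2 i, h.1]
  have h3 : Q.card ≤ L * ((s * 2 ^ d + 1) ^ d * P ^ (∑ k : Fin d, (k + 1 : ℕ))) := by
    simp only [Q, Finset.card_product, Finset.card_range, Fintype.card_piFinset]
    refine Nat.mul_le_mul_left _ ?_
    calc ∏ k : Fin d, (s * (2 * P) ^ (k + 1 : ℕ) + 1)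
        ≤ ∏ k : Fin d, ((s * 2 ^ d + 1) * P ^ (k + 1 : ℕ)) := by
          refine Finset.prod_le_prod' fun k _ => ?_
          have e1 : 2 ^ (k + 1 : ℕ) ≤ 2 ^ d := Nat.pow_le_pow_right (by norm_num) (by omega)
          have e2 : 1 ≤ P ^ (k + 1 : ℕ) := Nat.one_le_pow _ _ hP
          rw [mul_pow, add_mul, one_mul, ← mul_assoc]
          gcongr
      _ = _ := by
          rw [Finset.prod_mul_distrib, Finset.prod_pow_eq_pow_sum]
          simp
  obtain ⟨n, rfl⟩ : ∃ n, s = n + 1 := ⟨s - 1, by omega⟩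
  calc B.card ^ (2 * (n + 1)) = (B.card ^ (n + 1)) ^ 2 := by rw [← pow_mul, mul_comm]
    _ ≤ (L ^ (n + 1 - 1) * F.card) ^ 2 := Nat.pow_le_pow_left h1 2
    _ = L ^ (2 * n) * F.card ^ 2 := by rw [mul_pow, ← pow_mul, mul_comm 2]; simp
    _ ≤ L ^ (2 * n) * (Q.card * addEnergy (n + 1) (fun _ => φ) (B.image oddMulTwoPow)) := by gcongr
    _ ≤ L ^ (2 * n) * ((L * (((n + 1) * 2 ^ d + 1) ^ d * P ^ (∑ k : Fin d, (k + 1 : ℕ)))) *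
          addEnergy (n + 1) (fun _ => φ) (B.image oddMulTwoPow)) := by gcongr
    _ = _ := by
        rw [show 2 * (n + 1) - 1 = 2 * n + 1 by omega]
        ring

/-- A product of `s` of the integers is determined by the product of the odd parts and by the sum
of the exponents of `2`, which gives a lower bound for the multiplicative energy. -/
theorem card_pow_le_mulEnergy {s P L : ℕ} (hP : 1 ≤ P) (hL : 1 ≤ L)
    (B : Finset (ℕ × ℕ)) (hB1 : ∀ p ∈ B, p.1 < P) (hB2 : ∀ p ∈ B, p.2 < L) :
    B.card ^ (2 * s) ≤ (2 ^ s + 1) * (s + 1) * P ^ s * L *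
      mulEnergy s (fun _ => X) (B.image oddMulTwoPow) := by
  let Q : Finset (ℕ × ℕ) := Finset.range ((2 * P) ^ s + 1) ×ˢ Finset.range (s * L + 1)
  have h2 : (Fintype.piFinset fun _ : Fin s => B).card ^ 2 ≤
      Q.card * mulEnergy s (fun _ => X) (B.image oddMulTwoPow) := by
    refine card_sq_le_card_mul_mulEnergy _ oddMulTwoPow_injective _
      (fun x hx i => Finset.mem_image_of_mem _ (Fintype.mem_piFinset.1 hx i))
      (fun x => (∏ i, (2 * (x i).1 + 1), ∑ i, (x i).2)) Q ?_ ?_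
    · intro x hx
      rw [Fintype.mem_piFinset] at hx
      simp only [Q, Finset.mem_product, Finset.mem_range]
      constructor
      · refine Nat.lt_succ_of_le ?_
        refine (Finset.prod_le_pow_card _ _ (2 * P) fun i _ => ?_).trans (by simp)
        have := hB1 _ (hx i)
        omega
      · refine Nat.lt_succ_of_le ?_
        refine (Finset.sum_le_card_nsmul _ _ L fun i _ => ?_).trans (by simp)
        exact (hB2 _ (hx i)).le
    · intro x _ y _ h
      simp only [Prod.mk.injEq] at h
      exact prod_eq_of_prod_odd_eq h.1 h.2
  have h3 : Q.card ≤ ((2 ^ s + 1) * P ^ s) * ((s + 1) * L) := by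
    simp only [Q, Finset.card_product, Finset.card_range]
    refine Nat.mul_le_mul ?_ ?_
    · have := Nat.one_le_pow s P hP
      rw [mul_pow, add_mul, one_mul]
      gcongr
    · rw [add_mul, one_mul]
      gcongr
  calc B.card ^ (2 * s) = (Fintype.piFinset fun _ : Fin s => B).card ^ 2 := by
        rw [mul_comm, pow_mul]; simp
    _ ≤ _ := h2
    _ ≤ _ := Nat.mul_le_mul_right _ h3
    _ = _ := by ring

/-- The sets are `A = {(2 i + 1) 2 ^ j : i < P, j < L}` with `P = m ^ (2 s + D)`, `L = m ^ (s - D)` and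
`D = d (d + 1) / 2`. This ratio of `P` to `L` makes both energy bounds at least the required power
of `|A| = m ^ (3 s)`. -/
theorem exists_set_forall_dense_subset_energy_ge (d s : ℕ) (hd : 1 ≤ d)
    (hs : 10 * d * (d + 1) ≤ s) (φ : ℤ[X]) (hφ : φ.natDegree = d) :
    ∃ c : ℝ, 0 < c ∧ ∀ N : ℕ, ∃ A : Finset ℤ,
      (∀ a ∈ A, 0 < a) ∧ N ≤ A.card ∧
      ∀ B : Finset ℤ, B ⊆ A → (A.card : ℝ) / 2 ≤ (B.card : ℝ) →
        c * (A.card : ℝ) ^ ((s : ℝ) + (s : ℝ) / 3 - ((d : ℝ) ^ 2 + (d : ℝ) + 2) / 6) ≤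
            (addEnergy s (fun _ => φ) B : ℝ) ∧
        c * (A.card : ℝ) ^ ((s : ℝ) + (s : ℝ) / 3 - ((d : ℝ) ^ 2 + (d : ℝ) + 2) / 6) ≤
            (mulEnergy s (fun _ => X) B : ℝ) := by
  obtain ⟨D, hD⟩ : ∃ D, D = ∑ k : Fin d, (k + 1 : ℕ) := ⟨_, rfl⟩
  have hD2 : 2 * D = d * (d + 1) := by
    have h := Finset.sum_range_id_mul_two (d + 1)
    rw [Finset.sum_range_succ', ← Fin.sum_univ_eq_sum_range (fun k => k + 1) d] at h
    simp only [add_zero, Nat.add_sub_cancel] at h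
    rw [← hD] at h
    linarith
  have hDs : 20 * D ≤ s := by nlinarith
  have hD1 : 1 ≤ D := by nlinarith
  obtain ⟨C, hC, hC1, hC2⟩ : ∃ C : ℕ, 1 ≤ C ∧ (s * 2 ^ d + 1) ^ d ≤ C ∧
      (2 ^ s + 1) * (s + 1) ≤ C :=
    ⟨max ((s * 2 ^ d + 1) ^ d) ((2 ^ s + 1) * (s + 1)), le_max_of_le_left (Nat.one_le_pow _ _
      (by omega)), le_max_left _ _, le_max_right _ _⟩
  obtain ⟨r, hr⟩ : ∃ r, s = D + r := ⟨s - D, by omega⟩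
  refine ⟨1 / (4 ^ s * C), by positivity, fun N => ?_⟩
  set m := N + 1 with hm
  have hm1 : 1 ≤ m := by omega
  set I := Finset.range (m ^ (2 * s + D)) ×ˢ Finset.range (m ^ r) with hI
  have hcard : (I.image oddMulTwoPow).card = m ^ (3 * s) := by
    rw [Finset.card_image_of_injective _ oddMulTwoPow_injective, hI, Finset.card_product,
      Finset.card_range, Finset.card_range, ← pow_add]
    congr 1
    omega
  refine ⟨I.image oddMulTwoPow, ?_, ?_, ?_⟩
  · simp only [Finset.mem_image]
    rintro _ ⟨p, -, rfl⟩
    rw [oddMulTwoPow]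
    positivity
  · rw [hcard]
    calc N ≤ m ^ 1 := by rw [pow_one]; omega
      _ ≤ m ^ (3 * s) := Nat.pow_le_pow_right hm1 (by omega)
  intro B hBA hB
  obtain ⟨B, hBI, rfl⟩ : ∃ B' ⊆ I, B'.image oddMulTwoPow = B :=
    Finset.subset_image_iff.1 hBA
  rw [Finset.card_image_of_injective B oddMulTwoPow_injective, hcard] at hB
  rw [hcard]
  have hB1 : ∀ p ∈ B, p.1 < m ^ (2 * s + D) := fun p hp => by
    have := hBI hp
    simp only [hI, Finset.mem_product, Finset.mem_range] at this
    exact this.1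
  have hB2 : ∀ p ∈ B, p.2 < m ^ r := fun p hp => by
    have := hBI hp
    simp only [hI, Finset.mem_product, Finset.mem_range] at this
    exact this.2
  -- The exponent of `m` in `|A| ^ (s + s / 3 - (d ^ 2 + d + 2) / 6)`, where `|A| = m ^ (3 s)`.
  obtain ⟨E, hE⟩ : ∃ E, 4 * s ^ 2 = E + s * (D + 1) :=
    ⟨4 * s ^ 2 - s * (D + 1), by rw [Nat.sub_add_cancel]; nlinarith⟩
  have hpow : ((m ^ (3 * s) : ℕ) : ℝ) ^ ((s : ℝ) + (s : ℝ) / 3 - ((d : ℝ) ^ 2 + (d : ℝ) + 2) / 6) =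
      (m : ℝ) ^ E := by
    have e1 : (2 : ℝ) * D = d * (d + 1) := by exact_mod_cast hD2
    have e2 : (4 : ℝ) * s ^ 2 = E + s * (D + 1) := by exact_mod_cast hE
    have e3 : ((3 * s : ℕ) : ℝ) * ((s : ℝ) + (s : ℝ) / 3 - ((d : ℝ) ^ 2 + (d : ℝ) + 2) / 6) =
        (E : ℝ) := by
      push_cast
      linear_combination e2 + (s / 2 : ℝ) * e1
    rw [Nat.cast_pow, ← Real.rpow_natCast, ← Real.rpow_mul (by positivity), e3,
      Real.rpow_natCast]
  have hBpow : (m ^ (3 * s)) ^ (2 * s) ≤ 4 ^ s * B.card ^ (2 * s) := by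
    have : m ^ (3 * s) ≤ 2 * B.card := by
      have : ((m ^ (3 * s) : ℕ) : ℝ) ≤ ((2 * B.card : ℕ) : ℝ) := by
        push_cast at hB ⊢
        linarith
      exact_mod_cast this
    calc (m ^ (3 * s)) ^ (2 * s) ≤ (2 * B.card) ^ (2 * s) := Nat.pow_le_pow_left this _
      _ = _ := by rw [mul_pow, pow_mul]; norm_num
  rw [hpow]
  have finish : ∀ (w M : ℕ), E + w ≤ 6 * s ^ 2 → B.card ^ (2 * s) ≤ C * m ^ w * M →
      1 / (4 ^ s * (C : ℝ)) * (m : ℝ) ^ E ≤ M := by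
    intro w M hw h
    have h1 : m ^ w * m ^ E ≤ m ^ w * (4 ^ s * C * M) := by
      calc m ^ w * m ^ E = m ^ (E + w) := by rw [pow_add, mul_comm]
        _ ≤ m ^ (6 * s ^ 2) := Nat.pow_le_pow_right hm1 hw
        _ = (m ^ (3 * s)) ^ (2 * s) := by rw [← pow_mul]; congr 1; ring
        _ ≤ 4 ^ s * (C * m ^ w * M) := hBpow.trans (Nat.mul_le_mul_left _ h)
        _ = _ := by ring
    have h2 : m ^ E ≤ 4 ^ s * C * M := Nat.le_of_mul_le_mul_left h1 (by positivity)
    rw [one_div, inv_mul_le_iff₀ (by positivity)]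
    exact_mod_cast h2
  constructor
  · refine finish (r * (2 * s - 1) + (2 * s + D) * D) _ ?_ ?_
    · obtain ⟨q, hq⟩ : ∃ q, 2 * s - 1 = q := ⟨_, rfl⟩
      have hq' : 2 * s = q + 1 := by omega
      rw [hq]
      zify at hE hr hq' hDs hD1 ⊢
      have hq2 : (q : ℤ) = 2 * s - 1 := by linarith
      have hr2 : (r : ℤ) = s - D := by linarith
      rw [hq2, hr2]
      nlinarith
    · refine (card_pow_le_addEnergy (by omega) (Nat.one_le_pow _ _ hm1) hφ.le B hB1 hB2).trans ?_
      rw [← hD, mul_assoc (_ ^ d), ← pow_mul, ← pow_mul, ← pow_add]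
      gcongr
  · refine finish ((2 * s + D) * s + r) _ ?_ ?_
    · zify at hE hr ⊢
      nlinarith
    · refine (card_pow_le_mulEnergy (Nat.one_le_pow _ _ hm1) (Nat.one_le_pow _ _ hm1) B
        hB1 hB2).trans ?_
      rw [mul_assoc (_ * (s + 1)), ← pow_mul, ← pow_add]
      gcongr

/-! ### A Moore bound for multiplicative Sidon sets -/

/-- A bipartite graph with more than `a |U| + b |V|` edges has a nonempty subgraph in which every
vertex of the first side has degree greater than `a` and every vertex of the second side has degree
greater than `b`. -/
theorem exists_subset_forall_lt_degree {α β : Type*} [DecidableEq α] [DecidableEq β] (a b : ℕ)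
    (U : Finset α) (V : Finset β) (E : Finset (α × β)) (hE : E ⊆ U ×ˢ V)
    (h : a * U.card + b * V.card < E.card) :
    ∃ U' ⊆ U, ∃ V' ⊆ V, ∃ E' ⊆ E, E' ⊆ U' ×ˢ V' ∧ E'.Nonempty ∧
      (∀ u ∈ U', a < (E'.filter fun p => p.1 = u).card) ∧
      ∀ v ∈ V', b < (E'.filter fun p => p.2 = v).card := by
  induction hn : U.card + V.card using Nat.strong_induction_on generalizing U V E with
  | _ n ih =>
  by_cases hU : ∃ u ∈ U, (E.filter fun p => p.1 = u).card ≤ a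
  · obtain ⟨u, hu, hua⟩ := hU
    have hcard := Finset.card_erase_of_mem hu
    have hpos : 0 < U.card := Finset.card_pos.2 ⟨u, hu⟩
    have hsplit := Finset.card_filter_add_card_filter_not (s := E) (fun p => p.1 = u)
    obtain ⟨U', hU', V', hV', E', hE', h'⟩ := ih _ (by omega) (U.erase u) V
      (E.filter fun p => ¬ p.1 = u)
      (fun p hp => by
        have := Finset.mem_product.1 (hE (Finset.mem_of_mem_filter _ hp))
        exact Finset.mem_product.2 ⟨Finset.mem_erase.2 ⟨(Finset.mem_filter.1 hp).2, this.1⟩, this.2⟩)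
      (by
        obtain ⟨c, hc⟩ : ∃ c, U.card = c + 1 := ⟨U.card - 1, by omega⟩
        rw [hcard]
        rw [hc] at h ⊢
        rw [Nat.add_sub_cancel]
        rw [mul_add] at h
        omega) rfl
    exact ⟨U', hU'.trans (Finset.erase_subset _ _), V', hV', E',
      hE'.trans (Finset.filter_subset _ _), h'⟩
  by_cases hV : ∃ v ∈ V, (E.filter fun p => p.2 = v).card ≤ b
  · obtain ⟨v, hv, hvb⟩ := hV
    have hcard := Finset.card_erase_of_mem hv
    have hpos : 0 < V.card := Finset.card_pos.2 ⟨v, hv⟩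
    have hsplit := Finset.card_filter_add_card_filter_not (s := E) (fun p => p.2 = v)
    obtain ⟨U', hU', V', hV', E', hE', h'⟩ := ih _ (by omega) U (V.erase v)
      (E.filter fun p => ¬ p.2 = v)
      (fun p hp => by
        have := Finset.mem_product.1 (hE (Finset.mem_of_mem_filter _ hp))
        exact Finset.mem_product.2 ⟨this.1, Finset.mem_erase.2 ⟨(Finset.mem_filter.1 hp).2, this.2⟩⟩)
      (by
        obtain ⟨c, hc⟩ : ∃ c, V.card = c + 1 := ⟨V.card - 1, by omega⟩
        rw [hcard]
        rw [hc] at h ⊢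
        rw [Nat.add_sub_cancel]
        rw [mul_add b] at h
        omega) rfl
    exact ⟨U', hU', V', hV'.trans (Finset.erase_subset _ _), E',
      hE'.trans (Finset.filter_subset _ _), h'⟩
  push Not at hU hV
  exact ⟨U, subset_rfl, V, subset_rfl, E, subset_rfl, hE, Finset.card_pos.1 (by omega), hU, hV⟩

theorem exists_geodesic {V : Type*} {G : SimpleGraph V} {r x : V} {N : ℕ}
    (h : G.edist r x = N) :
    ∃ p : ℕ → V, p 0 = r ∧ p N = x ∧ (∀ j < N, G.Adj (p j) (p (j + 1))) ∧
      ∀ j ≤ N, G.edist r (p j) = j := by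
  obtain ⟨w, hw⟩ := SimpleGraph.exists_walk_of_edist_eq_coe h
  refine ⟨w.getVert, w.getVert_zero, by rw [← hw, w.getVert_length],
    fun j hj => w.adj_getVert_succ (by omega), fun j hj => le_antisymm ?_ ?_⟩
  · refine (SimpleGraph.edist_le (w.take j)).trans ?_
    rw [SimpleGraph.Walk.take_length]
    exact_mod_cast min_le_left _ _
  · have h1 : G.edist (w.getVert j) x ≤ ((N - j : ℕ) : ℕ∞) := by
      refine (SimpleGraph.edist_le (w.drop j)).trans ?_
      rw [SimpleGraph.Walk.drop_length, hw]
    have h2 : G.edist r x ≤ G.edist r (w.getVert j) + G.edist (w.getVert j) x :=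
      SimpleGraph.edist_triangle
    rw [h] at h2
    have h3 := h2.trans (add_le_add_right h1 _)
    have h4 : ((j : ℕ∞)) + ((N - j : ℕ) : ℕ∞) = N := by
      rw [← Nat.cast_add]
      congr 1
      omega
    rw [← h4] at h3
    exact (ENat.add_le_add_iff_right (ENat.natCast_ne_top _)).1 h3

/-- For two sequences with common end points, the alternating products along them agree. Applied to
the vertex labels of two interleaved paths, this is a multiplicative relation between edges. -/
theorem prod_mul_succ_comm {M : Type*} [CommMonoid M] {a b : ℕ → M} {N : ℕ}
    (h0 : a 0 = b 0) (hN : a (N + 1) = b (N + 1)) :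
    ∏ n ∈ Finset.range (N + 1), a n * b (n + 1) = ∏ n ∈ Finset.range (N + 1), b n * a (n + 1) := by
  rw [Finset.prod_mul_distrib, Finset.prod_mul_distrib, Finset.prod_range_succ' a,
    Finset.prod_range_succ' b, Finset.prod_range_succ (fun n => b (n + 1)),
    Finset.prod_range_succ (fun n => a (n + 1)), h0, hN]
  ac_rfl

/-- Within distance `s` of the root `r`, a vertex `y` has only one neighbour that is closer to `r`.
Geodesics to `y` through two such neighbours `x`, `x'` have the same end points, so the edges of one
of them taken alternately with the edges of the other give two equal products of edge labels. The
Sidon property makes the factors agree up to order; since the distance of an edge from `r` is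
determined by the edge, the last edges `x y` and `x' y` coincide. -/
theorem parent_unique_of_isMulSidon {V : Type*} {G : SimpleGraph V} {f : V → ℤ} {s : ℕ}
    {T : Finset ℤ} (hT : IsMulSidon s T) (hfT : ∀ x y, G.Adj x y → f x * f y ∈ T)
    (hf : ∀ x y z w, G.Adj x y → G.Adj z w → f x * f y = f z * f w →
      (x = z ∧ y = w) ∨ (x = w ∧ y = z))
    {r x x' y : V} {N : ℕ} (hN : N + 1 ≤ s) (hx : G.edist r x = N) (hx' : G.edist r x' = N)
    (hy : G.edist r y = (N + 1 : ℕ)) (hxy : G.Adj x y) (hxy' : G.Adj x' y) : x = x' := by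
  have extend : ∀ z, G.edist r z = N → G.Adj z y → ∃ p : ℕ → V, p 0 = r ∧ p N = z ∧
      p (N + 1) = y ∧ (∀ j ≤ N, G.Adj (p j) (p (j + 1))) ∧ ∀ j ≤ N + 1, G.edist r (p j) = j := by
    intro z hz hzy
    obtain ⟨p, h0, h1, h2, h3⟩ := exists_geodesic hz
    refine ⟨fun j => if j ≤ N then p j else y, by simpa using h0, by simpa using h1, by simp,
      fun j hj => ?_, fun j hj => ?_⟩
    · rcases hj.lt_or_eq with hj' | rfl
      · simpa [hj, Nat.succ_le_of_lt hj'] using h2 j hj'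
      · simpa [h1] using hzy
    · rcases hj.lt_or_eq with hj' | rfl
      · simpa [Nat.lt_succ_iff.1 hj'] using h3 j (Nat.lt_succ_iff.1 hj')
      · simpa using hy
  obtain ⟨p, p0, pN, pN1, padj, pd⟩ := extend x hx hxy
  obtain ⟨q, q0, qN, qN1, qadj, qd⟩ := extend x' hx' hxy'
  -- Interleave the two geodesics, so that the edge `x y` is the last one of the first product.
  set a : ℕ → V := fun n => if n % 2 = N % 2 then p n else q n with ha
  set b : ℕ → V := fun n => if n % 2 = N % 2 then q n else p n with hb
  have haN : a N = x := by simp [ha, pN]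
  have hbN : b N = x' := by simp [hb, qN]
  have haN1 : a (N + 1) = y := by simp [ha, pN1, qN1]
  have hbN1 : b (N + 1) = y := by simp [hb, pN1, qN1]
  have had : ∀ n ≤ N + 1, G.edist r (a n) = n := fun n hn => by
    simp only [ha]; split_ifs
    exacts [pd n hn, qd n hn]
  have hbd : ∀ n ≤ N + 1, G.edist r (b n) = n := fun n hn => by
    simp only [hb]; split_ifs
    exacts [qd n hn, pd n hn]
  have habadj : ∀ n ≤ N, G.Adj (a n) (b (n + 1)) := fun n hn => by
    simp only [ha, hb]
    split_ifs
    · omega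
    · exact padj n hn
    · exact qadj n hn
    · omega
  have hbaadj : ∀ n ≤ N, G.Adj (b n) (a (n + 1)) := fun n hn => by
    simp only [ha, hb]
    split_ifs
    · omega
    · exact qadj n hn
    · exact padj n hn
    · omega
  -- Both products are padded to `s` factors with the edge `x' y`.
  let P : ℕ → ℤ := fun n => if n < N + 1 then f (a n) * f (b (n + 1)) else f x' * f y
  let Q : ℕ → ℤ := fun n => if n < N + 1 then f (b n) * f (a (n + 1)) else f x' * f y
  have hPQ : ∏ n ∈ Finset.range s, P n = ∏ n ∈ Finset.range s, Q n := by
    obtain ⟨t, rfl⟩ := Nat.exists_eq_add_of_le hN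
    rw [Finset.prod_range_add P (N + 1) t, Finset.prod_range_add Q (N + 1) t]
    congr 1
    · have := prod_mul_succ_comm (a := fun n => f (a n)) (b := fun n => f (b n)) (N := N)
        (by simp [ha, hb, p0, q0]) (by simp only [haN1, hbN1])
      refine Eq.trans (Finset.prod_congr rfl fun n hn => ?_)
        (this.trans (Finset.prod_congr rfl fun n hn => ?_))
      · simp only [P, Finset.mem_range.1 hn, if_true]
      · simp only [Q, Finset.mem_range.1 hn, if_true]
    · refine Finset.prod_congr rfl fun n _ => ?_
      simp only [P, Q]
      rw [if_neg (by omega), if_neg (by omega)]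
  have hPT : ∀ n, P n ∈ T := fun n => by
    simp only [P]; split_ifs with h
    exacts [hfT _ _ (habadj n (by omega)), hfT _ _ hxy']
  have hQT : ∀ n, Q n ∈ T := fun n => by
    simp only [Q]; split_ifs with h
    exacts [hfT _ _ (hbaadj n (by omega)), hfT _ _ hxy']
  obtain ⟨σ, hσ⟩ := hT (fun i => P i) (fun i => Q i) (fun i => hPT i) (fun i => hQT i)
    (by rw [Fin.prod_univ_eq_prod_range, Fin.prod_univ_eq_prod_range, hPQ])
  obtain ⟨i, hi⟩ := σ.surjective ⟨N, hN⟩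
  have h := hσ i
  rw [hi] at h
  have hPN : P N = f x * f y := by simp [P, haN, hbN1]
  simp only [hPN] at h
  by_cases hiN : (i : ℕ) < N + 1
  · simp only [Q, hiN, if_true] at h
    rcases hf _ _ _ _ (hbaadj i (by omega)) hxy h with ⟨h1, -⟩ | ⟨h1, -⟩
    · have h2 := hbd i (by omega)
      rw [h1, hx] at h2
      have h3 : N = i := by exact_mod_cast h2
      rw [← h3, hbN] at h1
      exact h1.symm
    · have h2 := hbd i (by omega)
      rw [h1, hy] at h2
      have h3 : N + 1 = i := by exact_mod_cast h2
      omega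
  · simp only [Q, hiN, if_false] at h
    rcases hf _ _ _ _ hxy' hxy h with ⟨h1, -⟩ | ⟨h1, h2⟩
    · exact h1.symm
    · rw [h1, h2]

/-- The vertices of `W` at distance `i` from `r`. -/
noncomputable def layer {V : Type*} (G : SimpleGraph V) (r : V) (W : Finset V) (i : ℕ) :
    Finset V := by
  classical exact W.filter fun v => G.edist r v = i

theorem mem_layer {V : Type*} {G : SimpleGraph V} {r v : V} {W : Finset V} {i : ℕ} :
    v ∈ layer G r W i ↔ v ∈ W ∧ G.edist r v = i := by
  simp [layer]

/-- As long as parents are unique, each layer is larger than the preceding one by a factor of the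
minimal degree minus one. The coloring rules out edges inside a layer. -/
theorem card_layer_mul_le_card_layer_succ {V : Type*} {G : SimpleGraph V} (c : G.Coloring Bool)
    {r : V} {W : Finset V} {nb : V → Finset V} (hnb : ∀ x y, y ∈ nb x ↔ G.Adj x y)
    (hnbW : ∀ x, nb x ⊆ W) {s i δ : ℕ} (hi : i + 1 ≤ s)
    (huniq : ∀ N x x' y, N + 1 ≤ s → G.edist r x = N → G.edist r x' = N →
      G.edist r y = (N + 1 : ℕ) → G.Adj x y → G.Adj x' y → x = x')
    (hδ : ∀ x ∈ layer G r W i, δ < (nb x).card) :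
    (layer G r W i).card * δ ≤ (layer G r W (i + 1)).card := by
  classical
  have hsub : (layer G r W i).biUnion (fun x => (nb x).filter fun y => G.edist r y = (i + 1 : ℕ)) ⊆
      layer G r W (i + 1) := by
    intro y hy
    simp only [Finset.mem_biUnion, Finset.mem_filter] at hy
    obtain ⟨x, -, hy, hd⟩ := hy
    exact mem_layer.2 ⟨hnbW x hy, hd⟩
  refine le_trans ?_ (Finset.card_le_card hsub)
  rw [Finset.card_biUnion]
  · rw [← smul_eq_mul]
    refine Finset.card_nsmul_le_sum _ _ _ fun x hx => ?_
    have hsplit := Finset.card_filter_add_card_filter_not (s := nb x)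
      (fun y => G.edist r y = (i + 1 : ℕ))
    have hδx := hδ x hx
    obtain ⟨-, hxd⟩ := mem_layer.1 hx
    -- A neighbour of `x` that is not in the next layer is the parent of `x`.
    have hback : ∀ y ∈ (nb x).filter (fun y => ¬ G.edist r y = (i + 1 : ℕ)),
        G.Adj y x ∧ ∃ n, i = n + 1 ∧ G.edist r y = n := by
      intro y hy
      obtain ⟨hy, hne⟩ := Finset.mem_filter.1 hy
      have hadj := (hnb x y).1 hy
      have h1 : G.edist r y ≤ G.edist r x + G.edist x y := SimpleGraph.edist_triangle
      have h2 : G.edist r x ≤ G.edist r y + G.edist y x := SimpleGraph.edist_triangle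
      rw [SimpleGraph.edist_eq_one_iff_adj.2 hadj, hxd] at h1
      rw [SimpleGraph.edist_eq_one_iff_adj.2 hadj.symm, hxd] at h2
      obtain ⟨n, hn⟩ : ∃ n : ℕ, G.edist r y = n :=
        ⟨_, (ENat.natCast_toNat (ne_top_of_le_ne_top (ENat.natCast_ne_top (i + 1)) h1)).symm⟩
      rw [hn] at h1 h2 hne
      have h1' : n ≤ i + 1 := by exact_mod_cast h1
      have h2' : i ≤ n + 1 := by exact_mod_cast h2
      have hne' : n ≠ i + 1 := fun h => hne (by rw [h])
      have hpar : n ≠ i := by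
        rintro rfl
        obtain ⟨w, hw⟩ := SimpleGraph.exists_walk_of_edist_eq_coe hn
        obtain ⟨w', hw'⟩ := SimpleGraph.exists_walk_of_edist_eq_coe hxd
        have e1 := c.even_length_iff_congr w
        have e2 := c.even_length_iff_congr w'
        have e3 := c.valid hadj
        rw [hw] at e1
        rw [hw'] at e2
        revert e1 e2 e3
        cases c r <;> cases c x <;> cases c y <;> simp
      exact ⟨hadj.symm, n, by omega, hn⟩
    have hle : ((nb x).filter (fun y => ¬ G.edist r y = (i + 1 : ℕ))).card ≤ 1 := by
      refine Finset.card_le_one.2 fun y hy y' hy' => ?_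
      obtain ⟨ha, n, hn, hd⟩ := hback y hy
      obtain ⟨ha', n', hn', hd'⟩ := hback y' hy'
      obtain rfl : n = n' := by omega
      subst hn
      exact huniq n y y' x (by omega) hd hd' hxd ha ha'
    omega
  · intro x hx x' hx' hne
    refine Finset.disjoint_left.2 fun y hy hy' => hne ?_
    obtain ⟨hy, hd⟩ := Finset.mem_filter.1 hy
    obtain ⟨hy', -⟩ := Finset.mem_filter.1 hy'
    exact huniq i x x' y hi (mem_layer.1 hx).2 (mem_layer.1 hx').2 hd ((hnb _ _).1 hy)
      ((hnb _ _).1 hy')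

/-- The bipartite graph on `α ⊕ β` with edge set `E`. -/
def bipartiteGraph {α β : Type*} (E : Finset (α × β)) : SimpleGraph (α ⊕ β) where
  Adj x y := (∃ p ∈ E, x = .inl p.1 ∧ y = .inr p.2) ∨ ∃ p ∈ E, x = .inr p.2 ∧ y = .inl p.1
  symm := ⟨fun x y h => by
    rcases h with ⟨p, hp, hx, hy⟩ | ⟨p, hp, hx, hy⟩
    exacts [Or.inr ⟨p, hp, hy, hx⟩, Or.inl ⟨p, hp, hy, hx⟩]⟩
  loopless := ⟨fun x h => by
    rcases h with ⟨p, hp, hx, hy⟩ | ⟨p, hp, hx, hy⟩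
    all_goals rw [hx] at hy; simp at hy⟩

/-- If the products `u v` with `u ∈ U`, `v ∈ V` are distinct, a multiplicative Sidon set of such
products is the edge set of a bipartite graph whose balls of radius `s` are trees, so a Moore bound
applies: were there more edges, layer `s` around a vertex of a subgraph of large minimal degree
would lie in `U`, as `s` is even, and have at least `(a b) ^ (s / 2)` elements. -/
theorem card_le_of_isMulSidon {s a b : ℕ} (hs : Even s) {U V T : Finset ℤ}
    (hUV : ∀ u ∈ U, ∀ v ∈ V, ∀ u' ∈ U, ∀ v' ∈ V, u * v = u' * v' → u = u' ∧ v = v')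
    (hTUV : ∀ t ∈ T, ∃ u ∈ U, ∃ v ∈ V, u * v = t) (hT : IsMulSidon s T)
    (hab : U.card < (a * b) ^ (s / 2)) : T.card ≤ a * U.card + b * V.card := by
  by_contra hcon
  push Not at hcon
  set E₀ := (U ×ˢ V).filter fun p => p.1 * p.2 ∈ T with hE₀
  have hTE : T.card ≤ E₀.card := by
    refine Finset.card_le_card_of_surjOn (fun p => p.1 * p.2) fun t ht => ?_
    obtain ⟨u, hu, v, hv, rfl⟩ := hTUV t ht
    exact ⟨(u, v), by simpa [hE₀, hu, hv] using ht, rfl⟩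
  obtain ⟨U', hU', V', hV', E, hE, hEUV, ⟨e₀, he₀⟩, hdU, hdV⟩ :=
    exists_subset_forall_lt_degree a b U V E₀ (Finset.filter_subset _ _) (by omega)
  set G := bipartiteGraph E with hG
  set f : ℤ ⊕ ℤ → ℤ := Sum.elim id id with hf
  have hET : ∀ p ∈ E, p.1 * p.2 ∈ T := fun p hp => (Finset.mem_filter.1 (hE hp)).2
  have hEU : ∀ p ∈ E, p.1 ∈ U' ∧ p.2 ∈ V' := fun p hp => Finset.mem_product.1 (hEUV hp)
  have hinj : ∀ p ∈ E, ∀ q ∈ E, p.1 * p.2 = q.1 * q.2 → p = q := by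
    intro p hp q hq h
    have := hUV _ (hU' (hEU p hp).1) _ (hV' (hEU p hp).2) _ (hU' (hEU q hq).1) _
      (hV' (hEU q hq).2) h
    exact Prod.ext this.1 this.2
  have hadjT : ∀ x y, G.Adj x y → f x * f y ∈ T := by
    rintro x y (⟨p, hp, rfl, rfl⟩ | ⟨p, hp, rfl, rfl⟩)
    · simpa [hf] using hET p hp
    · simpa [hf, mul_comm] using hET p hp
  have hadjinj : ∀ x y z w, G.Adj x y → G.Adj z w → f x * f y = f z * f w →
      (x = z ∧ y = w) ∨ (x = w ∧ y = z) := by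
    rintro x y z w (⟨p, hp, rfl, rfl⟩ | ⟨p, hp, rfl, rfl⟩) (⟨q, hq, rfl, rfl⟩ | ⟨q, hq, rfl, rfl⟩) h
    all_goals
      have hpq : p = q := hinj p hp q hq (by
        simp only [hf, Sum.elim_inl, Sum.elim_inr, id] at h
        linarith [mul_comm p.1 p.2, mul_comm q.1 q.2])
      subst hpq
      simp
  let c : G.Coloring Bool := SimpleGraph.Coloring.mk Sum.isLeft (by
    rintro x y (⟨p, hp, rfl, rfl⟩ | ⟨p, hp, rfl, rfl⟩) <;> simp)
  let nb : ℤ ⊕ ℤ → Finset (ℤ ⊕ ℤ) := Sum.elim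
    (fun u => (E.filter fun p => p.1 = u).image fun p => Sum.inr p.2)
    (fun v => (E.filter fun p => p.2 = v).image fun p => Sum.inl p.1)
  have hnb : ∀ x y, y ∈ nb x ↔ G.Adj x y := by
    rintro (u | v) y
    · simp only [nb, Sum.elim_inl, Finset.mem_image, Finset.mem_filter, hG, bipartiteGraph,
        Sum.inl.injEq, reduceCtorEq, false_and, and_false, exists_false, or_false]
      exact ⟨fun ⟨p, ⟨h1, h2⟩, h3⟩ => ⟨p, h1, h2.symm, h3.symm⟩,
        fun ⟨p, h1, h2, h3⟩ => ⟨p, ⟨h1, h2.symm⟩, h3.symm⟩⟩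
    · simp only [nb, Sum.elim_inr, Finset.mem_image, Finset.mem_filter, hG, bipartiteGraph,
        Sum.inr.injEq, reduceCtorEq, false_and, and_false, exists_false, false_or]
      exact ⟨fun ⟨p, ⟨h1, h2⟩, h3⟩ => ⟨p, h1, h2.symm, h3.symm⟩,
        fun ⟨p, h1, h2, h3⟩ => ⟨p, ⟨h1, h2.symm⟩, h3.symm⟩⟩
  set W := U'.disjSum V' with hW
  have hnbW : ∀ x, nb x ⊆ W := by
    intro x y hy
    rcases (hnb x y).1 hy with ⟨p, hp, rfl, rfl⟩ | ⟨p, hp, rfl, rfl⟩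
    · simpa [hW] using (hEU p hp).2
    · simpa [hW] using (hEU p hp).1
  have hnbU : ∀ u ∈ U', a < (nb (.inl u)).card := by
    intro u hu
    simp only [nb, Sum.elim_inl]
    rw [Finset.card_image_of_injOn]
    · exact hdU u hu
    · intro p hp q hq h
      exact Prod.ext ((Finset.mem_filter.1 hp).2.trans (Finset.mem_filter.1 hq).2.symm)
        (Sum.inr_injective h)
  have hnbV : ∀ v ∈ V', b < (nb (.inr v)).card := by
    intro v hv
    simp only [nb, Sum.elim_inr]
    rw [Finset.card_image_of_injOn]
    · exact hdV v hv
    · intro p hp q hq h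
      exact Prod.ext (Sum.inl_injective h)
        ((Finset.mem_filter.1 hp).2.trans (Finset.mem_filter.1 hq).2.symm)
  set r : ℤ ⊕ ℤ := .inl e₀.1 with hr
  have hcolor : ∀ i, ∀ x ∈ layer G r W i, (Even i ↔ x.isLeft = true) := by
    intro i x hx
    obtain ⟨w, hw⟩ := SimpleGraph.exists_walk_of_edist_eq_coe (mem_layer.1 hx).2
    have := c.even_length_iff_congr w
    rw [hw] at this
    rw [this]
    simp [c, hr, SimpleGraph.Coloring.mk]
  have hgrow : ∀ i δ, i + 1 ≤ s → (∀ x ∈ layer G r W i, δ < (nb x).card) →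
      (layer G r W i).card * δ ≤ (layer G r W (i + 1)).card := fun i δ hi hδ =>
    card_layer_mul_le_card_layer_succ c hnb hnbW hi
      (fun N x x' y hN hx hx' hy h h' =>
        parent_unique_of_isMulSidon hT hadjT hadjinj hN hx hx' hy h h') hδ
  have heven : ∀ j, 2 * j ≤ s → (a * b) ^ j ≤ (layer G r W (2 * j)).card := by
    intro j
    induction j with
    | zero =>
      intro _
      rw [pow_zero]
      refine Finset.card_pos.2 ⟨r, mem_layer.2 ⟨?_, by simp⟩⟩
      simpa [hW, hr] using (hEU e₀ he₀).1
    | succ j ih =>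
      intro hj
      have h1 := hgrow (2 * j) a (by omega) (by
        intro x hx
        have hx1 := (hcolor _ x hx).1 (even_two_mul j)
        have hx2 := (mem_layer.1 hx).1
        rcases x with u | v
        · exact hnbU u (by simpa [hW] using hx2)
        · simp at hx1)
      have h2 := hgrow (2 * j + 1) b (by omega) (by
        intro x hx
        have hx1 := (hcolor _ x hx).not.1 (by simp)
        have hx2 := (mem_layer.1 hx).1
        rcases x with u | v
        · simp at hx1
        · exact hnbV v (by simpa [hW] using hx2))
      calc (a * b) ^ (j + 1) = (a * b) ^ j * a * b := by ring
        _ ≤ (layer G r W (2 * j)).card * a * b := by gcongr; exact ih (by omega)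
        _ ≤ (layer G r W (2 * j + 1)).card * b := by gcongr
        _ ≤ _ := h2
  obtain ⟨t, rfl⟩ := hs.two_dvd
  rw [Nat.mul_div_cancel_left _ (by norm_num)] at hab
  have hlast : (layer G r W (2 * t)).card ≤ U'.card := by
    refine Finset.card_le_card_of_surjOn Sum.inl fun x hx => ?_
    have hx1 := (hcolor _ x hx).1 (even_two_mul t)
    have hx2 := (mem_layer.1 hx).1
    rcases x with u | v
    · exact ⟨u, by simpa [hW] using hx2, rfl⟩
    · simp at hx1
  have := heven t le_rfl
  have := Finset.card_le_card hU'
  omega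

/-! ### Counting bound for additive Sidon sets -/

/-- Sums of `s` values of `φ` on `S` lie in `[-s T, s T]`, each is attained by at most `s!` tuples of
values, and each value of `φ` is taken at most `deg φ` times. -/
theorem card_pow_le_of_isAddSidon {s : ℕ} {φ : ℤ[X]} (hφ : 1 ≤ φ.natDegree) {S : Finset ℤ}
    (hS : IsAddSidon s φ S) {T : ℕ} (hT : ∀ x ∈ S, |φ.eval x| ≤ T) :
    S.card ^ s ≤ φ.natDegree ^ s * (s.factorial * (2 * s * T + 1)) := by
  classical
  set W := S.image fun x => φ.eval x with hW
  have h1 : S.card ≤ φ.natDegree * W.card := by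
    refine Finset.card_le_mul_card_image S _ fun w _ => ?_
    have hdeg : 0 < φ.degree := natDegree_pos_iff_degree_pos.1 hφ
    have hne : φ - C w ≠ 0 := fun h => by
      rw [sub_eq_zero.1 h] at hφ
      simp at hφ
    refine le_trans ?_ (card_roots_sub_C' (a := w) hdeg)
    refine le_trans (Finset.card_le_card ?_) (Multiset.toFinset_card_le _)
    intro x hx
    rw [Multiset.mem_toFinset, mem_roots hne, IsRoot, eval_sub, eval_C,
      (Finset.mem_filter.1 hx).2, sub_self]
  set F := Fintype.piFinset fun _ : Fin s => W with hF
  have h2 : F.card ≤ s.factorial * (F.image fun w => ∑ i, w i).card := by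
    refine Finset.card_le_mul_card_image F _ fun n hn => ?_
    obtain ⟨w₀, hw₀, rfl⟩ := Finset.mem_image.1 hn
    calc _ ≤ (Finset.univ.image fun σ : Equiv.Perm (Fin s) => w₀ ∘ σ).card := by
          refine Finset.card_le_card fun w hw => ?_
          obtain ⟨hw, hsum⟩ := Finset.mem_filter.1 hw
          have lift : ∀ v ∈ F, ∃ x : Fin s → ℤ, ∀ i, x i ∈ S ∧ φ.eval (x i) = v i := by
            intro v hv
            have : ∀ i, ∃ x, x ∈ S ∧ φ.eval x = v i := fun i => by
              simpa [hW] using Fintype.mem_piFinset.1 hv i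
            choose x hx using this
            exact ⟨x, hx⟩
          obtain ⟨x, hx⟩ := lift w₀ hw₀
          obtain ⟨y, hy⟩ := lift w hw
          obtain ⟨σ, hσ⟩ := hS x y (fun i => (hx i).1) (fun i => (hy i).1)
            (by simp only [(hx _).2, (hy _).2, hsum])
          refine Finset.mem_image.2 ⟨σ, Finset.mem_univ _, funext fun i => ?_⟩
          rw [Function.comp, ← (hx _).2, ← hσ i, (hy i).2]
      _ ≤ s.factorial := by
          refine Finset.card_image_le.trans ?_
          rw [Finset.card_univ, Fintype.card_perm, Fintype.card_fin]
  have h3 : (F.image fun w => ∑ i, w i).card ≤ 2 * s * T + 1 := by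
    calc _ ≤ (Finset.Icc (-(s * T : ℤ)) (s * T)).card := by
          refine Finset.card_le_card fun n hn => ?_
          obtain ⟨w, hw, rfl⟩ := Finset.mem_image.1 hn
          rw [Finset.mem_Icc, ← abs_le]
          refine (Finset.abs_sum_le_sum_abs _ _).trans ?_
          refine (Finset.sum_le_card_nsmul _ _ (T : ℤ) fun i _ => ?_).trans (by simp)
          obtain ⟨x, hx, hxw⟩ := Finset.mem_image.1 (Fintype.mem_piFinset.1 hw i)
          rw [← hxw]
          exact hT x hx
      _ = 2 * s * T + 1 := by
          rw [Int.card_Icc]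
          have : (s * T : ℤ) + 1 - -(s * T) = ((2 * s * T + 1 : ℕ) : ℤ) := by push_cast; ring
          rw [this, Int.toNat_natCast]
  calc S.card ^ s ≤ (φ.natDegree * W.card) ^ s := Nat.pow_le_pow_left h1 s
    _ = φ.natDegree ^ s * F.card := by rw [mul_pow]; simp [hF]
    _ ≤ _ := Nat.mul_le_mul_left _ (h2.trans (Nat.mul_le_mul_left _ h3))

theorem abs_eval_le (φ : ℤ[X]) {x M : ℕ} (hx : x ≤ M) (hM : 1 ≤ M) :
    |φ.eval (x : ℤ)| ≤
      (((∑ k ∈ Finset.range (φ.natDegree + 1), (φ.coeff k).natAbs) * M ^ φ.natDegree : ℕ) : ℤ) := by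
  rw [eval_eq_sum_range, Nat.cast_mul, Nat.cast_sum, Finset.sum_mul]
  refine (Finset.abs_sum_le_sum_abs _ _).trans (Finset.sum_le_sum fun k hk => ?_)
  rw [abs_mul, Int.natCast_natAbs, abs_pow, Nat.abs_cast]
  refine mul_le_mul_of_nonneg_left ?_ (abs_nonneg _)
  have h1 : x ^ k ≤ M ^ φ.natDegree := (Nat.pow_le_pow_left hx k).trans
    (Nat.pow_le_pow_right hM (Nat.lt_succ_iff.1 (Finset.mem_range.1 hk)))
  exact_mod_cast h1

/-! ### Products of integers and large primes -/

/-- Chebyshev's lower bound for the number of primes, without logarithms. -/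
theorem le_mul_primeCounting_succ {n b : ℕ} (hn : 2 ≤ n) (h : n + 1 ≤ 2 ^ b) :
    n ≤ b * (n.primeCounting + 1) := by
  have h1 := Chebyshev.pi_ge n
  have hlog2 : 0 < Real.log 2 := Real.log_pos (by norm_num)
  have hn' : (2 : ℝ) ≤ n := by exact_mod_cast hn
  have hlogn : 0 < Real.log n := Real.log_pos (by linarith)
  rw [div_le_iff₀ hlogn] at h1
  have h2 : Real.log (n + 1) ≤ b * Real.log 2 := by
    rw [← Real.log_pow]
    refine Real.log_le_log (by positivity) ?_
    exact_mod_cast h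
  have h3 : Real.log n ≤ Real.log (n + 1) := Real.log_le_log (by linarith) (by linarith)
  have h4 : (n.primeCounting : ℝ) * Real.log n ≤ n.primeCounting * (b * Real.log 2) :=
    mul_le_mul_of_nonneg_left (h3.trans h2) (Nat.cast_nonneg _)
  have h5 : (n : ℝ) * Real.log 2 ≤ (b * (n.primeCounting + 1)) * Real.log 2 := by
    nlinarith
  exact_mod_cast le_of_mul_le_mul_right h5 hlog2

/-- With `k = 2 ^ t`, there are `k ^ (s + 2)` primes exceeding `k ^ s` and of size
`O_s(k ^ (s + 2) log k)`. -/
theorem exists_primes_in_interval (s : ℕ) {t : ℕ} (ht : 1 ≤ t) (h : 4 * (s + 3) * t + 1 ≤ 2 ^ t) :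
    ∃ V : Finset ℕ, V.card = 2 ^ (t * (s + 2)) ∧
      ∀ p ∈ V, p.Prime ∧ 2 ^ (t * s) < p ∧ p ≤ 4 * (s + 3) * t * 2 ^ (t * (s + 2)) := by
  set K := 2 ^ (t * (s + 2)) with hK
  set n := 4 * (s + 3) * t * K with hn
  have hK1 : 1 ≤ K := Nat.one_le_two_pow
  have hst : 1 ≤ (s + 3) * t := Nat.mul_pos (by omega) ht
  have hnK : n = (s + 3) * t * (4 * K) := by rw [hn]; ring
  have hpi := le_mul_primeCounting_succ (n := n) (b := (s + 3) * t)
    (by rw [hnK]; nlinarith) (by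
      calc n + 1 ≤ (4 * (s + 3) * t + 1) * K := by rw [hn, add_mul]; omega
        _ ≤ 2 ^ t * K := Nat.mul_le_mul_right _ h
        _ = 2 ^ ((s + 3) * t) := by rw [hK, ← pow_add]; congr 1; ring)
  have hpi' : 4 * K ≤ n.primeCounting + 1 := by
    refine Nat.le_of_mul_le_mul_left ?_ hst
    rw [← hnK]
    exact hpi
  set R := (Finset.range (n + 1)).filter Nat.Prime with hR
  have hRcard : R.card = n.primeCounting := by
    rw [Nat.primeCounting, Nat.primeCounting', Nat.count_eq_card_filter_range]
  have hsplit := Finset.card_filter_add_card_filter_not (s := R) (fun p => p ≤ 2 ^ (t * s))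
  have hsmall : (R.filter fun p => p ≤ 2 ^ (t * s)).card ≤ K := by
    calc _ ≤ (Finset.Icc 1 (2 ^ (t * s))).card := by
          refine Finset.card_le_card fun p hp => ?_
          obtain ⟨hp1, hp2⟩ := Finset.mem_filter.1 hp
          exact Finset.mem_Icc.2 ⟨(Finset.mem_filter.1 hp1).2.one_le, hp2⟩
      _ ≤ K := by
          rw [Nat.card_Icc, Nat.add_sub_cancel]
          exact Nat.pow_le_pow_right (by norm_num) (Nat.mul_le_mul_left _ (by omega))
  obtain ⟨V, hV, hVcard⟩ := Finset.exists_subset_card_eq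
    (s := R.filter fun p => ¬ p ≤ 2 ^ (t * s)) (n := K) (by omega)
  refine ⟨V, hVcard, fun p hp => ?_⟩
  obtain ⟨hp1, hp2⟩ := Finset.mem_filter.1 (hV hp)
  obtain ⟨hp3, hp4⟩ := Finset.mem_filter.1 hp1
  exact ⟨hp4, not_le.1 hp2, Nat.lt_succ_iff.1 (Finset.mem_range.1 hp3)⟩

theorem eq_and_eq_of_mul_prime_eq {m : ℤ} {u v u' v' : ℤ} (hu : 1 ≤ u ∧ u ≤ m)
    (hu' : 1 ≤ u' ∧ u' ≤ m) (hv : Prime v ∧ m < v) (hv' : Prime v' ∧ m < v')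
    (h : u * v = u' * v') : u = u' ∧ v = v' := by
  have hvv : v = v' := by
    have hdvd : v ∣ u' * v' := h ▸ dvd_mul_left v u
    rcases hv.1.dvd_or_dvd hdvd with h1 | h1
    · have := Int.le_of_dvd (by linarith) h1
      linarith
    · exact Int.eq_of_associated_of_nonneg (hv.1.associated_of_dvd hv'.1 h1)
        (by linarith) (by linarith)
  subst hvv
  exact ⟨mul_right_cancel₀ hv.1.ne_zero h, rfl⟩

theorem sq_le_two_pow {t : ℕ} (ht : 4 ≤ t) : t ^ 2 ≤ 2 ^ t := by
  induction t, ht using Nat.le_induction with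
  | base => norm_num
  | succ n hn ih =>
    rw [pow_succ 2]
    nlinarith

/-- The two sides of the graph have `k ^ s` and `k ^ (s + 2)` vertices, where `k = 2 ^ t`. With the
degree thresholds `k ^ 2` and `2` the two terms of the Moore bound are of the same order
`k ^ (s + 2)`, and `(2 k ^ 2) ^ (s / 2) > k ^ s`. -/
theorem card_isMulSidon_le {s : ℕ} (hs : 1 ≤ s) (hs2 : Even s) {t : ℕ} {V : Finset ℤ}
    (hVcard : V.card = 2 ^ (t * (s + 2))) (hV : ∀ v ∈ V, Prime v ∧ 2 ^ (t * s) < v)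
    {T : Finset ℤ} (hTA : T ⊆ (Finset.Icc (1 : ℤ) (2 ^ (t * s)) ×ˢ V).image fun p => p.1 * p.2)
    (hT : IsMulSidon s T) : T.card ≤ 3 * 2 ^ (t * (s + 2)) := by
  have hU : (Finset.Icc (1 : ℤ) (2 ^ (t * s))).card = 2 ^ (t * s) := by
    rw [Int.card_Icc, add_sub_cancel_right]
    exact_mod_cast Int.toNat_natCast (2 ^ (t * s))
  have h := card_le_of_isMulSidon (a := 2 ^ (2 * t)) (b := 2) hs2
    (U := Finset.Icc (1 : ℤ) (2 ^ (t * s))) (V := V) (T := T)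
    (fun u hu v hv u' hu' v' hv' h => eq_and_eq_of_mul_prime_eq (Finset.mem_Icc.1 hu)
      (Finset.mem_Icc.1 hu') (hV v hv) (hV v' hv') h)
    (fun x hx => by
      obtain ⟨p, hp, rfl⟩ := Finset.mem_image.1 (hTA hx)
      obtain ⟨h1, h2⟩ := Finset.mem_product.1 hp
      exact ⟨_, h1, _, h2, rfl⟩) hT (by
      rw [hU]
      obtain ⟨q, rfl⟩ := hs2.two_dvd
      rw [Nat.mul_div_cancel_left _ (by norm_num), ← pow_succ, ← pow_mul]
      refine Nat.pow_lt_pow_right (by norm_num) ?_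
      have : t * (2 * q) = 2 * t * q := by ring
      rw [this, add_mul]
      omega)
  rw [hU, hVcard, ← pow_add, show 2 * t + t * s = t * (s + 2) by ring] at h
  omega

/-- If `S` is contained in an interval of length `O_s(n t)` and `t` is large in terms of `φ`, then
half of the factor `t ^ (2 d)` absorbs all dependence on the coefficients of `φ`. -/
theorem card_isAddSidon_le {s : ℕ} (hs : 1 ≤ s) {φ : ℤ[X]} (hφ : 1 ≤ φ.natDegree) {t : ℕ}
    (ht : 3 * s * (∑ k ∈ Finset.range (φ.natDegree + 1), (φ.coeff k).natAbs) *
      (4 * (s + 3)) ^ φ.natDegree ≤ t) {n : ℕ} (hn : 1 ≤ n) {S : Finset ℤ}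
    (hSn : ∀ x ∈ S, 0 ≤ x ∧ x ≤ (4 * (s + 3) * t * n : ℕ)) (hS : IsAddSidon s φ S) :
    S.card ^ s ≤ (φ.natDegree * s.factorial) ^ s *
      (n ^ φ.natDegree * ((2 * s + 2) * t) ^ (2 * φ.natDegree)) := by
  set d := φ.natDegree with hd
  set H := ∑ k ∈ Finset.range (d + 1), (φ.coeff k).natAbs with hHdef
  have hH : 1 ≤ H := by
    have h0 : φ.coeff d ≠ 0 := by
      rw [hd, coeff_natDegree, Ne, leadingCoeff_eq_zero]
      rintro rfl
      simp [hd] at hφ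
    exact (Int.natAbs_pos.2 h0).trans_le (Finset.single_le_sum (f := fun k => (φ.coeff k).natAbs)
      (fun _ _ => Nat.zero_le _) (Finset.mem_range.2 (Nat.lt_succ_self d)))
  have ht1 : 1 ≤ t := le_trans (Nat.one_le_iff_ne_zero.2 (by positivity)) ht
  have hM : 1 ≤ 4 * (s + 3) * t * n := Nat.one_le_iff_ne_zero.2 (by positivity)
  have h1 := card_pow_le_of_isAddSidon hφ hS (T := H * (4 * (s + 3) * t * n) ^ d) fun x hx => by
    obtain ⟨y, rfl⟩ := Int.eq_ofNat_of_zero_le (hSn x hx).1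
    exact abs_eval_le φ (by exact_mod_cast (hSn _ hx).2) hM
  have hT1 : 1 ≤ s * (H * (4 * (s + 3) * t * n) ^ d) := Nat.one_le_iff_ne_zero.2 (by positivity)
  have h2 : 2 * s * (H * (4 * (s + 3) * t * n) ^ d) + 1 ≤
      n ^ d * ((2 * s + 2) * t) ^ (2 * d) := by
    calc 2 * s * (H * (4 * (s + 3) * t * n) ^ d) + 1
        ≤ 3 * (s * (H * (4 * (s + 3) * t * n) ^ d)) := by rw [mul_assoc]; omega
      _ = (3 * s * H * (4 * (s + 3)) ^ d) * t ^ d * n ^ d := by rw [mul_pow, mul_pow]; ring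
      _ ≤ t ^ d * t ^ d * n ^ d := by
          gcongr
          exact ht.trans (Nat.le_self_pow (by omega) t)
      _ = n ^ d * t ^ (2 * d) := by ring
      _ ≤ n ^ d * ((2 * s + 2) * t) ^ (2 * d) := by
          gcongr
          nlinarith
  calc S.card ^ s ≤ _ := h1
    _ ≤ d ^ s * (s.factorial ^ s * (n ^ d * ((2 * s + 2) * t) ^ (2 * d))) := by
        gcongr
        exact Nat.le_self_pow (by omega) _
    _ = _ := by ring

/-- The sets are `A = {u v : 1 ≤ u ≤ k ^ s, v ∈ V}`, where `k = 2 ^ t` and `V` consists of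
`k ^ (s + 2)` primes exceeding `k ^ s`, so that `|A| = k ^ (2 s + 2)` and `log |A| = (2 s + 2) t`. -/
theorem exists_set_forall_sidon_subset_card_le (s : ℕ) (hs : 1 ≤ s) (hs2 : Even s) :
    ∃ K : ℝ, 0 < K ∧ ∀ d : ℕ, 1 ≤ d → ∃ C : ℝ, 0 < C ∧
      ∀ φ : ℤ[X], φ.natDegree = d →
        ∀ N : ℕ, ∃ A : Finset ℤ,
          (∀ a ∈ A, 0 < a) ∧ N ≤ A.card ∧
          (∀ S : Finset ℤ, S ⊆ A → IsAddSidon s φ S →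
            (S.card : ℝ) ≤ C * (A.card : ℝ) ^ ((d : ℝ) / (s : ℝ)) *
              Real.logb 2 (A.card : ℝ) ^ (2 * (d : ℝ) / (s : ℝ))) ∧
          (∀ T : Finset ℤ, T ⊆ A → IsMulSidon s T →
            (T.card : ℝ) ≤ K * (A.card : ℝ) ^ ((1 : ℝ) / 2 + 1 / (2 * (s : ℝ) + 2))) := by
  refine ⟨3, by norm_num, fun d hd => ⟨d * s.factorial, by positivity, fun φ hφ N => ?_⟩⟩
  -- The parameter `t` is large in terms of `φ`, so that `log |A|` absorbs its coefficients.
  obtain ⟨t, htN, ht1, ht2⟩ : ∃ t, N ≤ t ∧ 5 * (s + 3) ≤ t ∧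
      3 * s * (∑ k ∈ Finset.range (φ.natDegree + 1), (φ.coeff k).natAbs) *
        (4 * (s + 3)) ^ φ.natDegree ≤ t :=
    ⟨max N (max _ _), le_max_left _ _, (le_max_left _ _).trans (le_max_right _ _),
      (le_max_right _ _).trans (le_max_right _ _)⟩
  obtain ⟨P, hPcard, hP⟩ := exists_primes_in_interval s (t := t) (by omega)
    ((by nlinarith : 4 * (s + 3) * t + 1 ≤ t ^ 2).trans (sq_le_two_pow (by omega)))
  set V : Finset ℤ := P.image fun p : ℕ => (p : ℤ) with hVdef
  have hVcard : V.card = 2 ^ (t * (s + 2)) := by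
    rw [hVdef, Finset.card_image_of_injective _ Nat.cast_injective, hPcard]
  have hV : ∀ v ∈ V, (Prime v ∧ 2 ^ (t * s) < v) ∧
      v ≤ (4 * (s + 3) * t * 2 ^ (t * (s + 2)) : ℕ) := by
    intro v hv
    obtain ⟨p, hp, rfl⟩ := Finset.mem_image.1 hv
    obtain ⟨h1, h2, h3⟩ := hP p hp
    exact ⟨⟨Nat.prime_iff_prime_int.1 h1, by exact_mod_cast h2⟩, by exact_mod_cast h3⟩
  set U := Finset.Icc (1 : ℤ) (2 ^ (t * s)) with hU
  set A := (U ×ˢ V).image fun p => p.1 * p.2 with hA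
  have hcard : A.card = 2 ^ (t * (2 * s + 2)) := by
    rw [hA, Finset.card_image_of_injOn, Finset.card_product, hVcard, hU, Int.card_Icc,
      add_sub_cancel_right]
    · have : ((2 : ℤ) ^ (t * s)).toNat = 2 ^ (t * s) := by
        exact_mod_cast Int.toNat_natCast (2 ^ (t * s))
      rw [this, ← pow_add]
      congr 1
      ring
    · intro p hp q hq h
      obtain ⟨hp1, hp2⟩ := Finset.mem_product.1 hp
      obtain ⟨hq1, hq2⟩ := Finset.mem_product.1 hq
      have := eq_and_eq_of_mul_prime_eq (Finset.mem_Icc.1 hp1) (Finset.mem_Icc.1 hq1)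
        (hV _ hp2).1 (hV _ hq2).1 h
      exact Prod.ext this.1 this.2
  have hbound : ∀ a ∈ A, 0 < a ∧ a ≤ (4 * (s + 3) * t * 2 ^ (t * (2 * s + 2)) : ℕ) := by
    intro a ha
    obtain ⟨⟨u, v⟩, hp, rfl⟩ := Finset.mem_image.1 ha
    obtain ⟨hu, hv⟩ := Finset.mem_product.1 hp
    obtain ⟨hu1, hu2⟩ := Finset.mem_Icc.1 hu
    obtain ⟨⟨-, hv1⟩, hv2⟩ := hV v hv
    have hv0 : 0 < v := lt_trans (by positivity) hv1
    refine ⟨mul_pos (by linarith) hv0, ?_⟩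
    calc u * v ≤ 2 ^ (t * s) * (4 * (s + 3) * t * 2 ^ (t * (s + 2)) : ℕ) :=
          mul_le_mul hu2 hv2 hv0.le (by positivity)
      _ = _ := by
          push_cast
          rw [show t * (2 * s + 2) = t * s + t * (s + 2) by ring, pow_add]
          ring
  have hs0 : (s : ℝ) ≠ 0 := by positivity
  refine ⟨A, fun a ha => (hbound a ha).1, ?_, fun S hSA hS => ?_, fun T hTA hT => ?_⟩
  · rw [hcard]
    exact (htN.trans Nat.lt_two_pow_self.le).trans
      (Nat.pow_le_pow_right (by norm_num) (Nat.le_mul_of_pos_right _ (by omega)))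
  · have h := card_isAddSidon_le hs (by omega) ht2 (n := 2 ^ (t * (2 * s + 2)))
      Nat.one_le_two_pow (fun x hx => ⟨(hbound x (hSA hx)).1.le, (hbound x (hSA hx)).2⟩) hS
    rw [hφ, ← hcard] at h
    have hlog : Real.logb 2 (A.card : ℝ) = ((2 * s + 2) * t : ℕ) := by
      rw [hcard, Nat.cast_pow, Nat.cast_ofNat, ← Real.rpow_natCast,
        Real.logb_rpow (by norm_num) (by norm_num), mul_comm]
    rw [hlog]
    refine (pow_le_pow_iff_left₀ (by positivity) (by positivity) (n := s) (by omega)).1 ?_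
    rw [mul_pow _ _ s, mul_pow _ (_ ^ _) s, ← Real.rpow_mul_natCast (by positivity),
      ← Real.rpow_mul_natCast (by positivity), div_mul_cancel₀ _ hs0, div_mul_cancel₀ _ hs0,
      Real.rpow_natCast, show (2 * d : ℝ) = ((2 * d : ℕ) : ℝ) by push_cast; ring,
      Real.rpow_natCast, mul_assoc]
    exact_mod_cast h
  · have h := card_isMulSidon_le hs hs2 hVcard (fun v hv => (hV v hv).1) hTA hT
    have hpow : (A.card : ℝ) ^ ((1 : ℝ) / 2 + 1 / (2 * (s : ℝ) + 2)) = 2 ^ (t * (s + 2)) := by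
      have e : ((t * (2 * s + 2) : ℕ) : ℝ) * ((1 : ℝ) / 2 + 1 / (2 * (s : ℝ) + 2)) =
          ((t * (s + 2) : ℕ) : ℝ) := by
        have : (2 * (s : ℝ) + 2) ≠ 0 := by positivity
        push_cast
        field_simp
        ring
      rw [hcard, Nat.cast_pow, Nat.cast_ofNat, ← Real.rpow_natCast, ← Real.rpow_mul (by norm_num),
        e, Real.rpow_natCast]
    rw [hpow]
    exact_mod_cast h

theorem proposition1p5 :
    (∀ d s : ℕ, 1 ≤ d → 10 * d * (d + 1) ≤ s →
      ∀ φ : ℤ[X], φ.natDegree = d →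
        ∃ c : ℝ, 0 < c ∧ ∀ N : ℕ, ∃ A : Finset ℤ,
          (∀ a ∈ A, 0 < a) ∧ N ≤ A.card ∧
          ∀ B : Finset ℤ, B ⊆ A → (A.card : ℝ) / 2 ≤ (B.card : ℝ) →
            c * (A.card : ℝ) ^ ((s : ℝ) + (s : ℝ) / 3 - ((d : ℝ) ^ 2 + (d : ℝ) + 2) / 6) ≤
                (addEnergy s (fun _ => φ) B : ℝ) ∧
            c * (A.card : ℝ) ^ ((s : ℝ) + (s : ℝ) / 3 - ((d : ℝ) ^ 2 + (d : ℝ) + 2) / 6) ≤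
                (mulEnergy s (fun _ => X) B : ℝ)) ∧
    (∀ s : ℕ, 1 ≤ s → Even s →
      ∃ K : ℝ, 0 < K ∧ ∀ d : ℕ, 1 ≤ d → ∃ C : ℝ, 0 < C ∧
        ∀ φ : ℤ[X], φ.natDegree = d →
          ∀ N : ℕ, ∃ A : Finset ℤ,
            (∀ a ∈ A, 0 < a) ∧ N ≤ A.card ∧
            (∀ S : Finset ℤ, S ⊆ A → IsAddSidon s φ S →
              (S.card : ℝ) ≤ C * (A.card : ℝ) ^ ((d : ℝ) / (s : ℝ)) *
                Real.logb 2 (A.card : ℝ) ^ (2 * (d : ℝ) / (s : ℝ))) ∧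
            (∀ T : Finset ℤ, T ⊆ A → IsMulSidon s T →
              (T.card : ℝ) ≤ K * (A.card : ℝ) ^ ((1 : ℝ) / 2 + 1 / (2 * (s : ℝ) + 2)))) :=
  ⟨exists_set_forall_dense_subset_energy_ge, exists_set_forall_sidon_subset_card_le⟩
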